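/- Let $H$ be a finitely generated group, let $X$ be a finite proper normal subgroup of $H$, and let $G=\langle H,t\mid t^{-1}xt=x\ (x\in X)\rangle$ be the HNN extension of $H$ along the identity map $1_X\colon X\to X$. Let $S$ and $T$ be finite generating families of $H$ and of $G$, respectively; group elements are given as words over the generators and their inverses, and $\pi$ denotes evaluation of words. Then: (1) The rational subset membership problem for $H$ (input: a word $w$ over $S\cup S^{-1}$ and a finite automaton $\mathscr A$ over $S\cup S^{-1}$; question: is $\pi(w)\in\pi(L(\mathscr A))$?) is Turing reducible to the submonoid membership problem for $G$ (input: words $w,w_1,\dots,w_k$ over $T\cup T^{-1}$; question: does $\pi(w)$ lie in the submonoid generated by $\pi(w_1),\dots,\pi(w_k)$?). (2) If there is a fixed rational subset $R\subseteq H$ (i.e. $R=\pi(L(\mathscr A))$ for some finite automaton $\mathscr A$ over $S\cup S^{-1}$) for which the problem "given a word $w$ over $S\cup S^{-1}$, is $\pi(w)\in R$?" is undecidable, then there is a fixed finitely generated submonoid $M$ of $G$ for which the problem "given a word $w$ over $T\cup T^{-1}$, is $\pi(w)\in M$?" is undecidable. -/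

import Mathlib

/-- Words over the alphabet `Σ ∪ Σ⁻¹` attached to a generating family `Σ` with `n` members:
the letter `(i, true)` stands for the `i`-th generator, `(i, false)` for its inverse. -/
abbrev GroupWord (n : ℕ) : Type := List (Fin n × Bool)

/-- The canonical projection `π` from words over `Σ ∪ Σ⁻¹` to the group. -/
def wordValue {G : Type*} [Group G] {n : ℕ} (s : Fin n → G) (w : GroupWord n) : G :=
  (w.map fun a => if a.2 then s a.1 else (s a.1)⁻¹).prod

/-- The family `s` generates the group `G`. -/
def GeneratesGroup {G : Type*} [Group G] {n : ℕ} (s : Fin n → G) : Prop :=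
  Subgroup.closure (Set.range s) = ⊤

/-- A (nondeterministic) finite automaton over the alphabet `α`, given as a finite object
`(δ, q₀, F)`: the list `δ` of its transitions `(q, a, p)`, its initial state `q₀`, and the list `F`
of its final states. States are named by natural numbers; the finite state set consists of
the numbers that occur in `δ`, `q₀` and `F`. -/
abbrev FinAutomaton (α : Type) : Type := List (ℕ × α × ℕ) × ℕ × List ℕ

/-- The automaton as one of Mathlib's nondeterministic automata. -/
def FinAutomaton.toNFA {α : Type} (A : FinAutomaton α) : NFA α ℕ where
  step q a := {p | (q, a, p) ∈ A.1}
  start := {A.2.1}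
  accept := {q | q ∈ A.2.2}

/-- The set `π(L(A))` of group elements represented by words accepted by `A`. -/
def automatonSubset {G : Type*} [Group G] {n : ℕ} (s : Fin n → G)
    (A : FinAutomaton (Fin n × Bool)) : Set G :=
  {g | ∃ w : GroupWord n, w ∈ (FinAutomaton.toNFA A).accepts ∧ wordValue s w = g}

/-- Rational subsets of a group. -/
def IsRationalSubset {G : Type*} [Group G] {n : ℕ} (s : Fin n → G) (R : Set G) : Prop :=
  ∃ A : FinAutomaton (Fin n × Bool), R = automatonSubset s A

/-- The (uniform) rational subset membership problem: the input is a word `w` and a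
finite automaton `A`, the question is whether `π(w) ∈ π(L(A))`. -/
def RationalMembership {G : Type*} [Group G] {n : ℕ} (s : Fin n → G)
    (I : GroupWord n × FinAutomaton (Fin n × Bool)) : Prop :=
  wordValue s I.1 ∈ automatonSubset s I.2

/-- The (uniform) submonoid membership problem: the input is a word `w` and a list of words
`w₁, …, wₖ`, the question is whether `π(w)` lies in the submonoid generated by
`π(w₁), …, π(wₖ)`. -/
def SubmonoidMembership {G : Type*} [Group G] {n : ℕ} (s : Fin n → G)
    (I : GroupWord n × List (GroupWord n)) : Prop :=
  wordValue s I.1 ∈ Submonoid.closure {g : G | ∃ v ∈ I.2, wordValue s v = g}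

/-- The membership problem for a fixed subset `S` of the group: the input is a word `w`, the
question is whether `π(w) ∈ S`. -/
def FixedMembership {G : Type*} [Group G] {n : ℕ} (s : Fin n → G) (S : Set G)
    (w : GroupWord n) : Prop :=
  wordValue s w ∈ S

open Classical in
/-- The total `0`-`1`-valued characteristic function, on codes, of a decision problem. -/
noncomputable def problemCharFn {α : Type*} [Primcodable α] (p : α → Prop) : ℕ →. ℕ :=
  fun c => Part.some (if ∃ a : α, Encodable.decode c = some a ∧ p a then 1 else 0)

/-- The decision problem `p` can be (Turing) reduced to the decision problem `q`: there is an
algorithm for `p` that may query an oracle for `q`. -/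
def ProblemReducible {α β : Type*} [Primcodable α] [Primcodable β]
    (p : α → Prop) (q : β → Prop) : Prop :=
  TuringReducible (problemCharFn p) (problemCharFn q)

/-! The idea is to encode automata by submonoids of the extension. Fix `b ∉ X`. A state with code
`k` is marked by `t ^ (k + 1) * b * t ^ (k + 1)`, and an edge `(q, g, p)` becomes the segment
(marker of `q`) `* g *` (marker of `p`)⁻¹. Consecutive edges telescope, so a path from `q₀` to `f`
with label `w` puts the segment `(q₀, w, f)` into the submonoid generated by the edge segments.

Conversely, by Britton's lemma a nonempty product of segments lies in `H` only if two neighbours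
telescope or some segment is a loop `(q, x, q)` with `x ∈ X` (`exists_collapse`). Such a loop equals
`b * x * b⁻¹`. If all edge labels centralize `X`, it can be moved to the front and removed. Hence a
segment `(q₀, w, f)` in the submonoid satisfies `w = z * g`, where `g` is the label of a path from
`q₀` to `f` and `z` is a product of elements of `X` that label closed paths
(`exists_reach_of_segment_prod_eq_segment`).

Two corrections make this an exact test. First, the closed paths behind `z` may miss the path behind
`g`. The layered automaton of an edge list `l` cures this: climbing from layer `0` to layer
`l.length` uses every edge of `l`, so each closed path can be spliced into the path, and its label,
being in `X`, commutes to the front (`exists_isPath_mul_loop`). An arbitrary path is caught by the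
`l` that lists its edges by first occurrence, and there are finitely many candidates for `l`.
Second, labels are made to centralize `X` by passing to the product of the automaton with the
quotient of `H` by the centralizer of `X`, which is finite because `X` is finite and normal; labels
are corrected by coset representatives (`liftValue`).

Rational membership thus becomes a finite computable disjunction of submonoid membership questions
(`mem_automatonSubset_iff_exists_segment_mem`). For a fixed automaton only finitely many submonoids
occur, so if all of them were decidable, the rational subset would be decidable too. -/

namespace HNNExtension

/-- The HNN extension of a group along the identity map of the subgroup `X`. -/
abbrev SelfExtension {H : Type*} [Group H] (X : Subgroup H) : Type _ :=
  HNNExtension H X X (MulEquiv.refl X)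

/-! ### Reduced words and Britton's lemma -/

section Britton

variable {H : Type*} [Group H] {X : Subgroup H}

theorem commute_t_of {x : H} (hx : x ∈ X) : Commute (t : SelfExtension X) (of x) := by
  exact t_mul_of (φ := MulEquiv.refl X) ⟨x, hx⟩

theorem mem_toSubgroup_self_iff (u : ℤˣ) (x : H) :
    x ∈ toSubgroup X X u ↔ x ∈ X := by
  rcases Int.units_eq_one_or u with rfl | rfl <;> simp

/-- `y` is the product of a reduced word whose first letter is `t ^ u`. -/
def StartsWithSign (u : ℤˣ) (y : SelfExtension X) : Prop :=
  ∃ (h : H) (l : List (ℤˣ × H)),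
    ((u, h) :: l).IsChain (fun a b => a.2 ∈ X → a.1 = b.1) ∧
      y = (((u, h) :: l).map fun a => (t : SelfExtension X) ^ (a.1 : ℤ) * of a.2).prod

/-- `y` is the product of a reduced word that, up to a factor in `X`, begins with a stable
letter. -/
def StartsWithT (y : SelfExtension X) : Prop :=
  ∃ x ∈ X, ∃ (u : ℤˣ) (z : SelfExtension X), StartsWithSign u z ∧ y = of x * z

theorem StartsWithSign.startsWithT {u : ℤˣ} {y : SelfExtension X} (h : StartsWithSign u y) :
    StartsWithT y :=
  ⟨1, X.one_mem, u, y, h, by simp⟩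

theorem startsWithSign_t_zpow (u : ℤˣ) : StartsWithSign u ((t : SelfExtension X) ^ (u : ℤ)) :=
  ⟨1, [], by simp, by simp⟩

theorem StartsWithSign.zpow_mul {u : ℤˣ} {y : SelfExtension X} (h : StartsWithSign u y) :
    StartsWithSign u ((t : SelfExtension X) ^ (u : ℤ) * y) := by
  obtain ⟨h, l, hc, rfl⟩ := h
  exact ⟨1, (u, h) :: l, List.isChain_cons_cons.2 ⟨fun _ => rfl, hc⟩, by simp⟩

theorem StartsWithSign.zpow_pow_mul {u : ℤˣ} {y : SelfExtension X} (h : StartsWithSign u y) (n : ℕ) :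
    StartsWithSign u (((t : SelfExtension X) ^ (u : ℤ)) ^ n * y) := by
  induction n with
  | zero => simpa using h
  | succ n ih => simpa [pow_succ', mul_assoc] using ih.zpow_mul

/-- The last letter of the block is split off because the base element that follows the block is
attached to it in the reduced word. -/
theorem exists_zpow_eq_sign_pow {k : ℤ} (hk : k ≠ 0) :
    ∃ (u : ℤˣ) (n : ℕ), (t : SelfExtension X) ^ k = ((t : SelfExtension X) ^ (u : ℤ)) ^ n * (t : SelfExtension X) ^ (u : ℤ) := by
  obtain ⟨n, hn⟩ := Nat.exists_eq_succ_of_ne_zero (Int.natAbs_ne_zero.2 hk)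
  rcases Int.natAbs_eq k with h | h
  · refine ⟨1, n, ?_⟩
    rw [h, hn, ← pow_succ, zpow_natCast]
    simp
  · refine ⟨-1, n, ?_⟩
    rw [h, hn, ← pow_succ, zpow_neg, zpow_natCast]
    simp

theorem startsWithT_zpow {k : ℤ} (hk : k ≠ 0) : StartsWithT ((t : SelfExtension X) ^ k) := by
  obtain ⟨u, n, h⟩ := exists_zpow_eq_sign_pow (X := X) hk
  rw [h]
  exact ((startsWithSign_t_zpow u).zpow_pow_mul n).startsWithT

theorem StartsWithT.of_mul {x : H} (hx : x ∈ X) {y : SelfExtension X} (h : StartsWithT y) :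
    StartsWithT (of x * y) := by
  obtain ⟨x', hx', u, z, hz, rfl⟩ := h
  exact ⟨x * x', X.mul_mem hx hx', u, z, hz, by simp [mul_assoc]⟩

/-- Since `h` is outside `X`, no cancellation can occur at the junction, whatever the signs on its
two sides. -/
theorem StartsWithT.zpow_mul_of_mul {k : ℤ} (hk : k ≠ 0) {h : H} (hh : h ∉ X) {y : SelfExtension X}
    (hy : StartsWithT y) : StartsWithT ((t : SelfExtension X) ^ k * (of h * y)) := by
  obtain ⟨u, n, hu⟩ := exists_zpow_eq_sign_pow (X := X) hk
  obtain ⟨x, hx, u', _, ⟨h', l, hc, rfl⟩, rfl⟩ := hy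
  have hhx : h * x ∉ X := fun hmem => hh ((X.mul_mem_cancel_right hx).1 hmem)
  have key : StartsWithSign u ((t : SelfExtension X) ^ (u : ℤ) * (of h * (of x *
      (((u', h') :: l).map fun a => (t : SelfExtension X) ^ (a.1 : ℤ) * of a.2).prod))) :=
    ⟨h * x, (u', h') :: l, List.isChain_cons_cons.2 ⟨fun hmem => absurd hmem hhx, hc⟩,
      by simp [mul_assoc]⟩
  rw [hu, mul_assoc]
  exact (key.zpow_pow_mul n).startsWithT

theorem StartsWithT.notMem_range {y : SelfExtension X} (hy : StartsWithT y) :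
    y ∉ (of.range : Subgroup (SelfExtension X)) := by
  rintro hmem
  obtain ⟨x, hx, u, _, ⟨h, l, hc, rfl⟩, rfl⟩ := hy
  let w : NormalWord.ReducedWord H X X :=
    ⟨x, (u, h) :: l, hc.imp fun a b hab hm => hab ((mem_toSubgroup_self_iff _ _).1 hm)⟩
  have := ReducedWord.toList_eq_nil_of_mem_of_range (φ := MulEquiv.refl X) w hmem
  simp [w] at this

end Britton

/-! ### Segments encoding labelled edges -/

section Segments

variable {H : Type*} [Group H] {X : Subgroup H} {σ : Type*} [Encodable σ]

/-- The element of the extension that marks the state `q` of an automaton. -/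
def marker (X : Subgroup H) (b : H) (k : ℕ) : SelfExtension X :=
  t ^ (k + 1) * of b * t ^ (k + 1)

/-- The element of the extension that represents the transition `(q, g, p)`. -/
def segmentValue (X : Subgroup H) (b : H) (e : σ × H × σ) : SelfExtension X :=
  marker X b (Encodable.encode e.1) * of e.2.1 * (marker X b (Encodable.encode e.2.2))⁻¹

theorem segment_mul_segment (b : H) (q p r : σ) (g g' : H) :
    segmentValue X b (q, g, p) * segmentValue X b (p, g', r) = segmentValue X b (q, g * g', r) := by
  simp [segmentValue, mul_assoc]

theorem segment_inv (b : H) (q p : σ) (g : H) :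
    (segmentValue X b (q, g, p))⁻¹ = segmentValue X b (p, g⁻¹, q) := by
  simp [segmentValue, mul_assoc]

theorem marker_mul_of (b : H) (k : ℕ) {x : H} (hx : x ∈ X) (hX : X.Normal) :
    marker X b k * of x = of (b * x * b⁻¹) * marker X b k := by
  have hb : SemiconjBy (of b : SelfExtension X) (of x) (of (b * x * b⁻¹)) := by
    rw [SemiconjBy, ← map_mul, ← map_mul]
    simp
  exact ((((commute_t_of (hX.conj_mem x hx b)).pow_left (k + 1)).semiconjBy.mul_left hb).mul_left
    ((commute_t_of hx).pow_left (k + 1)).semiconjBy).eq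

theorem of_mul_segment (b : H) (q p : σ) (g : H) {x : H} (hx : x ∈ X) (hX : X.Normal) :
    of (b * x * b⁻¹) * segmentValue X b (q, g, p) = segmentValue X b (q, x * g, p) := by
  have h := marker_mul_of b (Encodable.encode q) hx hX
  simp only [segmentValue]
  rw [← mul_assoc, ← mul_assoc, ← h, map_mul, mul_assoc (marker X b _) (of x)]

theorem segment_self (b : H) (q : σ) {x : H} (hx : x ∈ X) (hX : X.Normal) :
    segmentValue X b (q, x, q) = of (b * x * b⁻¹) := by
  rw [segmentValue, marker_mul_of b _ hx hX]
  simp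

/-- As `t` centralizes `X`, every marker acts on `X` by conjugation as `b` does. The two markers of
a segment therefore cancel in this action, and `g` acts trivially. -/
theorem commute_of_segment (b : H) (q p : σ) {g : H}
    (hg : g ∈ Subgroup.centralizer (X : Set H)) {x : H} (hx : x ∈ X) (hX : X.Normal) :
    Commute (of x) (segmentValue X b (q, g, p)) := by
  obtain ⟨y, hy, rfl⟩ : ∃ y ∈ X, x = b * y * b⁻¹ :=
    ⟨b⁻¹ * x * b, by simpa using hX.conj_mem x hx b⁻¹, by group⟩
  have hm (k : ℕ) : SemiconjBy (marker X b k) (of y) (of (b * y * b⁻¹)) :=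
    marker_mul_of b k hy hX
  have hc : SemiconjBy (of g : SelfExtension X) (of y) (of y) := by
    rw [SemiconjBy, ← map_mul, ← map_mul, hg y hy]
  exact (((hm _).mul_left hc).mul_left (hm _).inv_symm_left).symm

/-- Both powers of `t` in a marker are needed: the outer ones meet between neighbouring segments,
the inner ones meet within a segment whose label is in `X`. In each case distinct states leave a
nonzero exponent. The leading block is kept visible in the conclusion so that it can merge with the
end of a preceding segment. -/
theorem startsWithT_segment_prod {b : H} (hb : b ∉ X) :
    ∀ (L : List (σ × H × σ)), L ≠ [] → L.IsChain (fun e f => e.2.2 ≠ f.1) →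
      (∀ e ∈ L, e.1 = e.2.2 → e.2.1 ∉ X) →
      ∃ (q : σ) (y : SelfExtension X), (∃ e ∈ L.head?, e.1 = q) ∧ StartsWithT y ∧
        (L.map (segmentValue X b)).prod = t ^ (Encodable.encode q + 1) * (of b * y)
  | [], h, _, _ => absurd rfl h
  | (q, g, p) :: L, _, hc, hL => by
    have hb' : b⁻¹ ∉ X := fun h => hb (by simpa using X.inv_mem h)
    obtain ⟨z, hz, hLz⟩ : ∃ z : SelfExtension X, StartsWithT z ∧
        (t ^ (Encodable.encode p + 1))⁻¹ * (L.map (segmentValue X b)).prod = z := by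
      refine ⟨_, ?_, rfl⟩
      rcases eq_or_ne L [] with rfl | hne
      -- The shift by one in the markers keeps this exponent nonzero even for the state with code
      -- `0`.
      · have := startsWithT_zpow (X := X) (k := -(Encodable.encode p + 1 : ℕ)) (by omega)
        rw [zpow_neg, zpow_natCast] at this
        simpa using this
      · obtain ⟨q', y, ⟨e, he, rfl⟩, hy, hprod⟩ := startsWithT_segment_prod hb L hne
          hc.tail (fun e he => hL e (List.mem_cons_of_mem _ he))
        have hne' : p ≠ e.1 := (List.isChain_cons.1 hc).1 e he
        have hk : ((Encodable.encode e.1 + 1 : ℕ) : ℤ) - (Encodable.encode p + 1 : ℕ) ≠ 0 := by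
          intro h
          exact hne' (Encodable.encode_injective (by omega))
        have := hy.zpow_mul_of_mul hk hb
        rw [sub_eq_neg_add, zpow_add, zpow_neg, zpow_natCast, zpow_natCast] at this
        rw [hprod, ← mul_assoc]
        exact this
    refine ⟨q, t ^ (Encodable.encode q + 1) * (of g * ((t ^ (Encodable.encode p + 1))⁻¹ *
      (of b⁻¹ * z))), ⟨_, rfl, rfl⟩, ?_, ?_⟩
    · by_cases hg : g ∈ X
      -- Here `g` slides to the left through the powers of `t`, and the two inner blocks merge into
      -- one with nonzero exponent.
      · have hqp : q ≠ p := fun h => hL (q, g, p) List.mem_cons_self h hg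
        have hk : ((Encodable.encode q + 1 : ℕ) : ℤ) - (Encodable.encode p + 1 : ℕ) ≠ 0 := by
          intro h
          exact hqp (Encodable.encode_injective (by omega))
        have := (hz.zpow_mul_of_mul hk hb').of_mul hg
        rw [sub_eq_add_neg, zpow_add, zpow_neg, zpow_natCast, zpow_natCast] at this
        rw [← mul_assoc, ((commute_t_of hg).pow_left _).eq, mul_assoc]
        simpa [mul_assoc] using this
      · have h1 := hz.zpow_mul_of_mul (k := -(Encodable.encode p + 1 : ℕ)) (by omega) hb'
        have h2 := h1.zpow_mul_of_mul (k := (Encodable.encode q + 1 : ℕ)) (by omega) hg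
        rwa [zpow_neg, zpow_natCast, zpow_natCast] at h2
    · rw [← hLz]
      simp [segmentValue, marker, mul_assoc]

theorem exists_collapse {b : H} (hb : b ∉ X) {L : List (σ × H × σ)} (hne : L ≠ [])
    (hL : (L.map (segmentValue X b)).prod ∈ (of.range : Subgroup (SelfExtension X))) :
    (∃ A B q g p g' r, L = A ++ (q, g, p) :: (p, g', r) :: B) ∨
      ∃ A B q x, x ∈ X ∧ L = A ++ (q, x, q) :: B := by
  by_contra! hcon
  obtain ⟨q, y, -, hy, hprod⟩ := startsWithT_segment_prod hb L hne
    (List.isChain_iff_forall_rel_of_append_cons_cons.2 (by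
      rintro ⟨q, g, p⟩ ⟨p', g', r⟩ A B rfl (rfl : p = p')
      exact hcon.1 A B q g p g' r rfl))
    (by
      rintro ⟨q, g, p⟩ he (rfl : q = p) hg
      obtain ⟨A, B, rfl⟩ := List.append_of_mem he
      exact hcon.2 A B q g hg rfl)
  rw [hprod] at hL
  have := hy.zpow_mul_of_mul (k := (Encodable.encode q + 1 : ℕ)) (by omega) hb
  rw [zpow_natCast] at this
  exact this.notMem_range hL

end Segments

end HNNExtension

/-! ### Paths in labelled graphs and the submonoid of edge segments -/

namespace HNNExtension

section Reachability

variable {H : Type*} [Group H] {σ : Type*}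

/-- `Reach E q g p` means that `g` is the label of a path from `q` to `p` in the labelled graph
with edge set `E`. -/
inductive Reach (E : Set (σ × H × σ)) (q : σ) : H → σ → Prop
  | refl : Reach E q 1 q
  | tail {g c : H} {p r : σ} : Reach E q g p → (p, c, r) ∈ E → Reach E q (g * c) r

theorem Reach.trans {E : Set (σ × H × σ)} {q p r : σ} {g g' : H} (h : Reach E q g p)
    (h' : Reach E p g' r) : Reach E q (g * g') r := by
  induction h' with
  | refl => simpa using h
  | tail _ he ih => simpa [mul_assoc] using ih.tail he

theorem Reach.mono {E E' : Set (σ × H × σ)} (hE : E ⊆ E') {q p : σ} {g : H}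
    (h : Reach E q g p) : Reach E' q g p := by
  induction h with
  | refl => exact .refl
  | tail _ he ih => exact ih.tail (hE he)

theorem Reach.mem_subgroup {E : Set (σ × H × σ)} {C : Subgroup H} (hE : ∀ e ∈ E, e.2.1 ∈ C)
    {q p : σ} {g : H} (h : Reach E q g p) : g ∈ C := by
  induction h with
  | refl => exact C.one_mem
  | tail _ he ih => exact C.mul_mem ih (hE _ he)

/-- The submonoid of `X` generated by the labels in `X` of closed paths. -/
def loopSubmonoid (X : Subgroup H) (E : Set (σ × H × σ)) : Submonoid H :=
  Submonoid.closure {x | x ∈ X ∧ ∃ r, Reach E r x r}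

variable {E : Set (σ × H × σ)}

theorem forall_reach_merge {A B : List (σ × H × σ)} {q p r : σ} {g g' : H}
    (h : ∀ e ∈ A ++ (q, g, p) :: (p, g', r) :: B, Reach E e.1 e.2.1 e.2.2) :
    ∀ e ∈ A ++ (q, g * g', r) :: B, Reach E e.1 e.2.1 e.2.2 := by
  intro e he
  rw [List.mem_append, List.mem_cons] at he
  rcases he with he | rfl | he
  · exact h e (by simp [he])
  · exact (h (q, g, p) (by simp)).trans (h (p, g', r) (by simp))
  · exact h e (by simp [he])

theorem forall_reach_remove {A B : List (σ × H × σ)} {d : σ × H × σ}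
    (h : ∀ e ∈ A ++ d :: B, Reach E e.1 e.2.1 e.2.2) :
    ∀ e ∈ A ++ B, Reach E e.1 e.2.1 e.2.2 :=
  fun e' he => h e' (by
    rw [List.mem_append, List.mem_cons]
    rw [List.mem_append] at he
    tauto)

end Reachability

section Membership

variable {H : Type*} [Group H] {X : Subgroup H} {σ : Type*} [Encodable σ]

theorem commute_of_segment_prod (b : H) {x : H} (hx : x ∈ X) (hX : X.Normal) :
    ∀ L : List (σ × H × σ), (∀ e ∈ L, e.2.1 ∈ Subgroup.centralizer (X : Set H)) →
      Commute (of x) (L.map (segmentValue X b)).prod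
  | [], _ => by simp
  | e :: L, hL => by
    rw [List.map_cons, List.prod_cons]
    exact (commute_of_segment b e.1 e.2.2 (hL e List.mem_cons_self) hx hX).mul_right
      (commute_of_segment_prod b hx hX L fun e he => hL e (List.mem_cons_of_mem _ he))

theorem segment_prod_remove_loop {b : H} (hX : X.Normal) {A B : List (σ × H × σ)} {q : σ} {x : H}
    (hx : x ∈ X) (hA : ∀ e ∈ A, e.2.1 ∈ Subgroup.centralizer (X : Set H)) :
    ((A ++ (q, x, q) :: B).map (segmentValue X b)).prod =
      of (b * x * b⁻¹) * ((A ++ B).map (segmentValue X b)).prod := by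
  have := (commute_of_segment_prod b (hX.conj_mem x hx b) hX A hA).eq
  simp only [List.map_append, List.map_cons, List.prod_append, List.prod_cons,
    segment_self b q hx hX]
  rw [← mul_assoc, ← this, mul_assoc]

theorem segment_prod_merge {b : H} {A B : List (σ × H × σ)} {q p r : σ} {g g' : H} :
    ((A ++ (q, g, p) :: (p, g', r) :: B).map (segmentValue X b)).prod =
      ((A ++ (q, g * g', r) :: B).map (segmentValue X b)).prod := by
  simp only [List.map_append, List.map_cons, List.prod_append, List.prod_cons,
    ← segment_mul_segment b q p r, mul_assoc]

variable {E : Set (σ × H × σ)}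

/-- Induction on the number of segments: each collapse either merges two segments into one or
extracts a factor `b * x * b⁻¹`. -/
theorem exists_loop_of_segment_prod_eq_of {b : H} (hb : b ∉ X) (hX : X.Normal)
    (hE : ∀ e ∈ E, e.2.1 ∈ Subgroup.centralizer (X : Set H)) (L : List (σ × H × σ))
    (hL : ∀ e ∈ L, Reach E e.1 e.2.1 e.2.2) (y : H)
    (hy : (L.map (segmentValue X b)).prod = of y) :
    ∃ z ∈ loopSubmonoid X E, y = b * z * b⁻¹ := by
  rcases eq_or_ne L [] with rfl | hne
  · refine ⟨1, one_mem _, ?_⟩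
    have : (of y : SelfExtension X) = of 1 := by simpa using hy.symm
    simpa using of_injective _ this
  rcases exists_collapse hb hne (hy ▸ ⟨y, rfl⟩) with
    ⟨A, B, q, g, p, g', r, rfl⟩ | ⟨A, B, q, x, hx, rfl⟩
  · exact exists_loop_of_segment_prod_eq_of hb hX hE _ (forall_reach_merge hL) y
      (segment_prod_merge.symm.trans hy)
  · have hA : ∀ e ∈ A, e.2.1 ∈ Subgroup.centralizer (X : Set H) := fun e he =>
      (hL e (by simp [he])).mem_subgroup hE
    rw [segment_prod_remove_loop hX hx hA, ← eq_inv_mul_iff_mul_eq, ← map_inv, ← map_mul] at hy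
    obtain ⟨z, hz, h⟩ := exists_loop_of_segment_prod_eq_of hb hX hE (A ++ B)
      (forall_reach_remove hL) _ hy
    refine ⟨x * z, mul_mem (Submonoid.subset_closure ⟨hx, q, hL (q, x, q) (by simp)⟩) hz, ?_⟩
    rw [inv_mul_eq_iff_eq_mul] at h
    rw [h]
    group
termination_by L.length

/-- Appending the inverse of the target segment gives a product equal to `1`, which must collapse.
The cases record whether the collapse involves this last segment. Its label `w⁻¹` need not
centralize `X`, which is harmless because loops are moved to the left. -/
theorem exists_reach_of_segment_prod_eq_segment {b : H} (hb : b ∉ X) (hX : X.Normal)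
    (hE : ∀ e ∈ E, e.2.1 ∈ Subgroup.centralizer (X : Set H)) (q₀ : σ) (L : List (σ × H × σ))
    (hL : ∀ e ∈ L, Reach E e.1 e.2.1 e.2.2) (w : H) (f : σ)
    (hw : (L.map (segmentValue X b)).prod = segmentValue X b (q₀, w, f)) :
    ∃ z ∈ loopSubmonoid X E, ∃ g, Reach E q₀ g f ∧ w = z * g := by
  have hprod : ((L ++ [(f, w⁻¹, q₀)]).map (segmentValue X b)).prod = of 1 := by
    rw [List.map_append, List.prod_append, hw, List.map_singleton, List.prod_singleton,
      ← segment_inv, mul_inv_cancel, map_one]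
  rcases exists_collapse hb (List.append_ne_nil_of_right_ne_nil L (List.cons_ne_nil _ _))
      (hprod ▸ ⟨1, rfl⟩ : ((L ++ [(f, w⁻¹, q₀)]).map (segmentValue X b)).prod ∈ of.range) with
    ⟨A, B, q, g, p, g', r, hAB⟩ | ⟨A, B, q, x, hx, hAB⟩
  · rcases List.eq_nil_or_concat B with rfl | ⟨B, e, rfl⟩
    -- The last segment of `L` ends in `f`; it is the final step of the path and is cancelled from
    -- the target.
    · obtain ⟨rfl, he⟩ := List.append_inj' (s₁ := L) (t₁ := [(f, w⁻¹, q₀)]) (s₂ := A ++ [(q, g, p)])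
        (t₂ := [(p, g', r)]) (by simpa using hAB) rfl
      obtain ⟨rfl, -, -⟩ : f = p ∧ w⁻¹ = g' ∧ q₀ = r := by simpa using he
      rw [List.map_append, List.prod_append, List.map_singleton, List.prod_singleton,
        ← eq_mul_inv_iff_mul_eq, segment_inv, segment_mul_segment] at hw
      obtain ⟨z, hz, g', hg', h⟩ := exists_reach_of_segment_prod_eq_segment hb hX hE q₀ A
        (fun e he => hL e (by simp [he])) _ _ hw
      refine ⟨z, hz, _, hg'.trans (hL (q, g, f) (by simp)), ?_⟩
      rw [← mul_assoc, ← h]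
      simp
    · obtain ⟨rfl, -⟩ := List.append_inj' (s₁ := L) (t₁ := [(f, w⁻¹, q₀)])
        (s₂ := A ++ (q, g, p) :: (p, g', r) :: B) (t₂ := [e]) (by simpa using hAB) rfl
      exact exists_reach_of_segment_prod_eq_segment hb hX hE q₀ _ (forall_reach_merge hL) w f
        (segment_prod_merge.symm.trans hw)
  · rcases List.eq_nil_or_concat B with rfl | ⟨B, e, rfl⟩
    -- The target itself is a loop with label in `X`, so the product lies in `H` and the empty path
    -- serves.
    · obtain ⟨rfl, he⟩ := List.append_inj' (s₁ := L) (t₁ := [(f, w⁻¹, q₀)]) (s₂ := A)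
        (t₂ := [(q, x, q)]) (by simpa using hAB) rfl
      obtain ⟨rfl, rfl, rfl⟩ : f = q ∧ w⁻¹ = x ∧ q₀ = f := by
        have : f = q ∧ w⁻¹ = x ∧ q₀ = q := by simpa using he
        exact ⟨this.1, this.2.1, this.2.2.trans this.1.symm⟩
      have hwX : w ∈ X := by simpa using X.inv_mem hx
      rw [segment_self b _ hwX hX] at hw
      obtain ⟨z, hz, h⟩ := exists_loop_of_segment_prod_eq_of hb hX hE L hL _ hw
      exact ⟨z, hz, 1, .refl, by simpa using h⟩
    · obtain ⟨rfl, -⟩ := List.append_inj' (s₁ := L) (t₁ := [(f, w⁻¹, q₀)])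
        (s₂ := A ++ (q, x, q) :: B) (t₂ := [e]) (by simpa using hAB) rfl
      have hA : ∀ e ∈ A, e.2.1 ∈ Subgroup.centralizer (X : Set H) := fun e he =>
        (hL e (by simp [he])).mem_subgroup hE
      -- The extracted factor is carried to the target, where it changes `w` into `x⁻¹ * w`.
      rw [segment_prod_remove_loop hX hx hA, ← eq_inv_mul_iff_mul_eq, ← map_inv,
        show (b * x * b⁻¹)⁻¹ = b * x⁻¹ * b⁻¹ by group,
        of_mul_segment b _ _ _ (X.inv_mem hx) hX] at hw
      obtain ⟨z, hz, g, hg, h⟩ := exists_reach_of_segment_prod_eq_segment hb hX hE q₀ (A ++ B)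
        (forall_reach_remove hL) _ _ hw
      refine ⟨x * z, mul_mem (Submonoid.subset_closure ⟨hx, q, hL (q, x, q) (by simp)⟩) hz,
        g, hg, ?_⟩
      rw [mul_assoc, ← h]
      simp
termination_by L.length

theorem segment_mem_closure {b : H} {q p : σ} {g : H} (h : Reach E q g p) :
    segmentValue X b (q, g, p) ∈ Submonoid.closure (segmentValue X b '' E) := by
  induction h with
  | refl => simp [segmentValue]
  | tail _ he ih =>
    rw [← segment_mul_segment b q]
    exact mul_mem ih (Submonoid.subset_closure ⟨_, he, rfl⟩)

theorem exists_reach_of_segment_mem_closure {b : H} (hb : b ∉ X) (hX : X.Normal)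
    (hE : ∀ e ∈ E, e.2.1 ∈ Subgroup.centralizer (X : Set H)) {q₀ f : σ} {w : H}
    (hw : segmentValue X b (q₀, w, f) ∈ Submonoid.closure (segmentValue X b '' E)) :
    ∃ z ∈ loopSubmonoid X E, ∃ g, Reach E q₀ g f ∧ w = z * g := by
  obtain ⟨l, hl, hprod⟩ := Submonoid.exists_list_of_mem_closure hw
  obtain ⟨L, hL, rfl⟩ : ∃ L : List (σ × H × σ), (∀ e ∈ L, e ∈ E) ∧ L.map (segmentValue X b) = l := by
    clear hprod
    induction l with
    | nil => exact ⟨[], by simp⟩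
    | cons y l ih =>
      obtain ⟨L, hL, rfl⟩ := ih fun y hy => hl y (List.mem_cons_of_mem _ hy)
      obtain ⟨e, he, rfl⟩ := hl y List.mem_cons_self
      exact ⟨e :: L, List.forall_mem_cons.2 ⟨he, hL⟩, rfl⟩
  refine exists_reach_of_segment_prod_eq_segment hb hX hE q₀ L (fun e he => ?_) w f hprod
  simpa using (Reach.refl (E := E) (q := e.1)).tail (hL e he)

end Membership

end HNNExtension

/-! ### Edge paths and the layered automaton -/

namespace LabelledPath

variable {τ Λ : Type*}

/-- The list of edges `l` is a path from `q` to `p`. -/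
def IsPath : τ → List (τ × Λ × τ) → τ → Prop
  | q, [], p => q = p
  | q, e :: l, p => e.1 = q ∧ IsPath e.2.2 l p

@[simp]
theorem isPath_nil {q p : τ} : IsPath (Λ := Λ) q [] p ↔ q = p := Iff.rfl

@[simp]
theorem isPath_cons {q p : τ} {e : τ × Λ × τ} {l : List (τ × Λ × τ)} :
    IsPath q (e :: l) p ↔ e.1 = q ∧ IsPath e.2.2 l p := Iff.rfl

theorem isPath_append {l l' : List (τ × Λ × τ)} {q p : τ} :
    IsPath q (l ++ l') p ↔ ∃ r, IsPath q l r ∧ IsPath r l' p := by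
  induction l generalizing q with
  | nil => simp
  | cons e l ih => simp [ih, and_assoc]

/-- The product of the values of the labels along a path. -/
def pathValue {H : Type*} [Monoid H] (v : Λ → H) (l : List (τ × Λ × τ)) : H :=
  (l.map fun e => v e.2.1).prod

section

variable {H : Type*} [Monoid H] (v : Λ → H)

@[simp]
theorem pathValue_nil : pathValue v ([] : List (τ × Λ × τ)) = 1 := rfl

@[simp]
theorem pathValue_cons (e : τ × Λ × τ) (l : List (τ × Λ × τ)) :
    pathValue v (e :: l) = v e.2.1 * pathValue v l := by
  simp [pathValue]

@[simp]
theorem pathValue_append (l l' : List (τ × Λ × τ)) :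
    pathValue v (l ++ l') = pathValue v l * pathValue v l' := by
  simp [pathValue]

end

/-- The edges of the layered automaton attached to a list `l` of edges: the layers
`0, …, l.length` are copies of the graph with edge list `l`, and the `i`-th member of `l` leads from
layer `i` to layer `i + 1`. -/
def layeredEdges (l : List (τ × Λ × τ)) : List ((τ × ℕ) × Λ × (τ × ℕ)) :=
  (List.range (l.length + 1)).flatMap fun i =>
    (l.map fun e => ((e.1, i), e.2.1, (e.2.2, i))) ++
      (l[i]?.map fun e => ((e.1, i), e.2.1, (e.2.2, i + 1))).toList

theorem mem_layeredEdges {l : List (τ × Λ × τ)} {d : (τ × ℕ) × Λ × (τ × ℕ)} :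
    d ∈ layeredEdges l ↔ ∃ i ≤ l.length,
      (∃ e ∈ l, ((e.1, i), e.2.1, (e.2.2, i)) = d) ∨
        ∃ e, l[i]? = some e ∧ ((e.1, i), e.2.1, (e.2.2, i + 1)) = d := by
  simp only [layeredEdges, List.mem_flatMap, List.mem_range, Nat.lt_succ_iff, List.mem_append,
    List.mem_map, Option.mem_toList, Option.map_eq_some_iff]

/-- The edge set of the layered automaton, with labels evaluated in a group. -/
def layeredEdgeSet {H : Type*} (v : Λ → H) (l : List (τ × Λ × τ)) :
    Set ((τ × ℕ) × H × (τ × ℕ)) :=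
  {e | ∃ d ∈ layeredEdges l, (d.1, v d.2.1, d.2.2) = e}

theorem layeredEdgeSet_mono_append {H : Type*} (v : Λ → H) (l l' : List (τ × Λ × τ)) :
    layeredEdgeSet v l ⊆ layeredEdgeSet v (l ++ l') := by
  rintro _ ⟨d, hd, rfl⟩
  refine ⟨d, ?_, rfl⟩
  rw [mem_layeredEdges] at hd ⊢
  obtain ⟨i, hi, ⟨e, he, rfl⟩ | ⟨e, he, rfl⟩⟩ := hd
  · exact ⟨i, by simp; omega, .inl ⟨e, by simp [he], rfl⟩⟩
  · refine ⟨i, by simp; omega, .inr ⟨e, ?_, rfl⟩⟩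
    rw [List.getElem?_append_left (List.getElem?_eq_some_iff.1 he).1, he]

section Reach

open HNNExtension

variable {H : Type*} [Group H] (v : Λ → H) {l : List (τ × Λ × τ)}

/-- The only way from layer `k` to layer `k + 1` is the `k`-th edge of `l`, so every layer crossed
forces an edge into the path. -/
theorem exists_isPath_of_reach {s s' : τ × ℕ} {g : H} (h : Reach (layeredEdgeSet v l) s g s') :
    ∃ π, IsPath s.1 π s'.1 ∧ pathValue v π = g ∧ π ⊆ l ∧ s.2 ≤ s'.2 ∧
      ∀ k e, s.2 ≤ k → k < s'.2 → l[k]? = some e → e ∈ π := by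
  induction h with
  | refl => exact ⟨[], by simp, by simp, by simp, le_rfl, fun k e h h' => by omega⟩
  | tail _ he ih =>
    obtain ⟨π, hπ, rfl, hl, hle, hk⟩ := ih
    obtain ⟨d, hd, heq⟩ := he
    obtain ⟨i, hi, ⟨e, he, rfl⟩ | ⟨e, he, rfl⟩⟩ := mem_layeredEdges.1 hd
    · simp only [Prod.mk.injEq] at heq
      obtain ⟨rfl, rfl, rfl⟩ := heq
      refine ⟨π ++ [e], isPath_append.2 ⟨_, hπ, by simp⟩, by simp, ?_, hle, ?_⟩
      · simpa using ⟨hl, he⟩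
      · intro k e' h1 h2 h3
        simp [hk k e' h1 h2 h3]
    · simp only [Prod.mk.injEq] at heq
      obtain ⟨rfl, rfl, rfl⟩ := heq
      refine ⟨π ++ [e], isPath_append.2 ⟨_, hπ, by simp⟩, by simp, ?_, by simp at hle ⊢; omega, ?_⟩
      · simpa using ⟨hl, List.mem_of_getElem? he⟩
      · intro k e' h1 h2 h3
        rcases Nat.lt_succ_iff_lt_or_eq.1 h2 with h2 | rfl
        · simp [hk k e' h1 h2 h3]
        · simp [Option.some.inj (h3.symm.trans he)]

theorem exists_reach_of_isPath (q : τ) (π : List (τ × Λ × τ)) :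
    ∀ p, IsPath q π p → ∃ l, l.Nodup ∧ l ⊆ π ∧
      Reach (layeredEdgeSet v l) (q, 0) (pathValue v π) (p, l.length) := by
  induction π using List.reverseRecOn with
  | nil =>
    rintro p rfl
    exact ⟨[], by simp, by simp, by simpa using Reach.refl⟩
  | append_singleton π e ih =>
    intro p hp
    obtain ⟨r, hr, rfl, rfl⟩ := isPath_append.1 hp
    obtain ⟨l, hl, hsub, hreach⟩ := ih _ hr
    -- The list collects edges by first occurrence: a repeated edge stays in the top layer, a new
    -- one leads to a new top layer.
    by_cases he : e ∈ l
    · refine ⟨l, hl, List.Subset.trans hsub (by simp), ?_⟩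
      rw [pathValue_append]
      refine hreach.tail ⟨_, mem_layeredEdges.2 ⟨l.length, le_rfl, .inl ⟨e, he, rfl⟩⟩, ?_⟩
      simp
    · refine ⟨l ++ [e], ?_, ?_, ?_⟩
      · rw [List.nodup_append]
        refine ⟨hl, by simp, ?_⟩
        rintro a ha b hb rfl
        exact he (by rwa [List.mem_singleton.1 hb] at ha)
      · exact List.append_subset.2 ⟨List.Subset.trans hsub (by simp), by simp⟩
      · rw [pathValue_append, List.length_append]
        refine (hreach.mono (layeredEdgeSet_mono_append v l [e])).tail
          ⟨_, mem_layeredEdges.2 ⟨l.length, by simp, .inr ⟨e, by simp, rfl⟩⟩, ?_⟩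
        simp

theorem commute_pathValue {X : Subgroup H} {x : H} (hx : x ∈ X) {π : List (τ × Λ × τ)}
    (hv : ∀ e ∈ π, v e.2.1 ∈ Subgroup.centralizer (X : Set H)) :
    x * pathValue v π = pathValue v π * x := by
  induction π with
  | nil => simp
  | cons e π ih =>
    rw [pathValue_cons, ← mul_assoc, hv e List.mem_cons_self x hx, mul_assoc, mul_assoc,
      ih fun e he => hv e (List.mem_cons_of_mem _ he)]

/-- A nonempty closed path is spliced in just before an occurrence of its first edge. Its value is
in `X` and commutes with the value of the initial part of the path. The condition `l ⊆ π` is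
preserved so that splicing can be repeated. -/
theorem exists_isPath_mul_loop {X : Subgroup H}
    (hv : ∀ e ∈ l, v e.2.1 ∈ Subgroup.centralizer (X : Set H)) {q p : τ} {z : H}
    (hz : z ∈ loopSubmonoid X (layeredEdgeSet v l)) :
    ∀ π, IsPath q π p → π ⊆ l → l ⊆ π →
      ∃ π', IsPath q π' p ∧ π' ⊆ l ∧ l ⊆ π' ∧ pathValue v π' = z * pathValue v π := by
  induction hz using Submonoid.closure_induction with
  | one => exact fun π h h' h'' => ⟨π, h, h', h'', by simp⟩
  | mul z z' _ _ ih ih' =>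
    intro π h1 h2 h3
    obtain ⟨π', h1, h2, h3, h⟩ := ih' π h1 h2 h3
    obtain ⟨π'', h1, h2, h3, h'⟩ := ih π' h1 h2 h3
    exact ⟨π'', h1, h2, h3, by rw [h', h, mul_assoc]⟩
  | mem x hx =>
    obtain ⟨hxX, s, hs⟩ := hx
    obtain ⟨ρ, hρ, rfl, hρl, -, -⟩ := exists_isPath_of_reach v hs
    intro π hπ hπl hlπ
    rcases ρ with _ | ⟨e, ρ⟩
    · exact ⟨π, hπ, hπl, hlπ, by simp⟩
    obtain ⟨A, B, rfl⟩ := List.append_of_mem (hlπ (hρl List.mem_cons_self))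
    obtain ⟨r, hA, he, hB⟩ := isPath_append.1 hπ
    obtain ⟨hes, hρ'⟩ := hρ
    refine ⟨A ++ ((e :: ρ) ++ e :: B), isPath_append.2 ⟨r, hA, isPath_append.2
      ⟨r, ⟨he, ?_⟩, he, hB⟩⟩, ?_, ?_, ?_⟩
    · rwa [← he, hes]
    · simp only [List.append_subset] at hπl ⊢
      exact ⟨hπl.1, hρl, hπl.2⟩
    · refine List.Subset.trans hlπ ?_
      intro d hd
      simp only [List.mem_append, List.mem_cons] at hd ⊢
      tauto
    · rw [pathValue_append, pathValue_append, pathValue_append, ← mul_assoc, ← mul_assoc,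
        commute_pathValue v hxX fun d hd => hv d (hπl (by simp [hd]))]

theorem exists_isPath_of_segment_mem_closure [Encodable τ] {X : Subgroup H} {b : H} (hb : b ∉ X)
    (hX : X.Normal) (hv : ∀ e ∈ l, v e.2.1 ∈ Subgroup.centralizer (X : Set H)) {q p : τ} {w : H}
    (hw : segmentValue X b ((q, 0), w, (p, l.length)) ∈
      Submonoid.closure (segmentValue X b '' layeredEdgeSet v l)) :
    ∃ π, IsPath q π p ∧ π ⊆ l ∧ pathValue v π = w := by
  obtain ⟨z, hz, g, hg, rfl⟩ := exists_reach_of_segment_mem_closure hb hX (by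
    rintro _ ⟨d, hd, rfl⟩
    obtain ⟨i, hi, ⟨e, he, rfl⟩ | ⟨e, he, rfl⟩⟩ := mem_layeredEdges.1 hd
    · exact hv e he
    · exact hv e (List.mem_of_getElem? he)) hw
  obtain ⟨π, h1, rfl, h2, -, h3⟩ := exists_isPath_of_reach v hg
  obtain ⟨π', h1, h2, -, h⟩ := exists_isPath_mul_loop v hv hz π h1 h2 (by
    intro e he
    obtain ⟨k, hk, rfl⟩ := List.getElem_of_mem he
    exact h3 k _ (Nat.zero_le k) hk (List.getElem?_eq_getElem hk))
  exact ⟨π', h1, h2, h⟩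

end Reach

end LabelledPath

/-! ### Words, powers and bounded lists -/

section Words

variable {G : Type*} [Group G] {n : ℕ}

/-- The value of a letter of `Σ ∪ Σ⁻¹`. -/
def letterValue (s : Fin n → G) (a : Fin n × Bool) : G :=
  if a.2 then s a.1 else (s a.1)⁻¹

theorem wordValue_eq (s : Fin n → G) (w : GroupWord n) :
    wordValue s w = (w.map (letterValue s)).prod := rfl

@[simp]
theorem wordValue_nil (s : Fin n → G) : wordValue s [] = 1 := rfl

@[simp]
theorem wordValue_append (s : Fin n → G) (w w' : GroupWord n) :
    wordValue s (w ++ w') = wordValue s w * wordValue s w' := by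
  simp [wordValue_eq]

theorem wordValue_cons (s : Fin n → G) (a : Fin n × Bool) (w : GroupWord n) :
    wordValue s (a :: w) = letterValue s a * wordValue s w := by
  simp [wordValue_eq]

theorem wordValue_flatMap {K : Type*} [Group K] {m : ℕ} (f : K →* G) (r : Fin m → K)
    (s : Fin n → G) (c : Fin m × Bool → GroupWord n)
    (hc : ∀ a, wordValue s (c a) = f (letterValue r a)) (w : GroupWord m) :
    wordValue s (w.flatMap c) = f (wordValue r w) := by
  induction w with
  | nil => simp
  | cons a w ih => rw [List.flatMap_cons, wordValue_append, ih, hc, wordValue_cons, map_mul]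

theorem wordValue_surjective {s : Fin n → G} (hs : GeneratesGroup s) :
    Function.Surjective (wordValue s) := by
  intro g
  have hg : g ∈ Subgroup.closure (Set.range s) := hs ▸ Subgroup.mem_top g
  induction hg using Subgroup.closure_induction_left with
  | one => exact ⟨[], rfl⟩
  | mul_left x hx y _ ih =>
    obtain ⟨i, rfl⟩ := hx
    obtain ⟨w, rfl⟩ := ih
    exact ⟨(i, true) :: w, by simp [wordValue_cons, letterValue]⟩
  | inv_mul_cancel x hx y _ ih =>
    obtain ⟨i, rfl⟩ := hx
    obtain ⟨w, rfl⟩ := ih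
    exact ⟨(i, false) :: w, by simp [wordValue_cons, letterValue]⟩

/-- The `k`-th power of a word. -/
def wordPow (w : GroupWord n) (k : ℕ) : GroupWord n :=
  (List.range k).flatMap fun _ => w

theorem wordValue_wordPow (s : Fin n → G) (w : GroupWord n) (k : ℕ) :
    wordValue s (wordPow w k) = wordValue s w ^ k := by
  induction k with
  | zero => simp [wordPow]
  | succ k ih =>
    rw [wordPow] at ih ⊢
    rw [List.range_succ, List.flatMap_append, wordValue_append, ih]
    simp [pow_succ]

end Words

/-- All lists of length at most `k` with entries in `L`. -/
def boundedLists {α : Type*} (L : List α) : ℕ → List (List α)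
  | 0 => [[]]
  | k + 1 => [] :: (boundedLists L k).flatMap fun l => L.map fun a => a :: l

theorem mem_boundedLists {α : Type*} {L : List α} {k : ℕ} {l : List α} :
    l ∈ boundedLists L k ↔ l.length ≤ k ∧ l ⊆ L := by
  induction k generalizing l with
  | zero => cases l <;> simp [boundedLists]
  | succ k ih =>
    cases l with
    | nil => simp [boundedLists]
    | cons a l =>
      simp only [boundedLists, List.mem_cons, List.mem_flatMap, List.mem_map, ih]
      constructor
      · rintro (h | ⟨l', ⟨h1, h2⟩, a', ha', h⟩)
        · cases h
        · obtain ⟨rfl, rfl⟩ := List.cons.inj h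
          exact ⟨by simpa using h1, List.cons_subset.2 ⟨ha', h2⟩⟩
      · rintro ⟨h1, h2⟩
        rw [List.cons_subset] at h2
        exact .inr ⟨l, ⟨by simpa using h1, h2.2⟩, a, h2.1, rfl⟩

/-! ### Automata as path problems and the product with a finite transition system -/

namespace LabelledPath

theorem exists_path_word {α : Type} (A : FinAutomaton α) {q p : ℕ} (w : List α) :
    p ∈ A.toNFA.evalFrom {q} w ↔ ∃ π, π ⊆ A.1 ∧ IsPath q π p ∧ π.map (fun e => e.2.1) = w := by
  induction w generalizing q with
  | nil =>
    simp only [NFA.evalFrom_nil, Set.mem_singleton_iff, List.map_eq_nil_iff]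
    constructor
    · rintro rfl
      exact ⟨[], by simp⟩
    · rintro ⟨_, -, h, rfl⟩
      exact h.symm
  | cons a w ih =>
    rw [NFA.evalFrom_cons, NFA.stepSet_singleton, NFA.mem_evalFrom_iff_exists]
    constructor
    · rintro ⟨r, hr, hp⟩
      obtain ⟨π, h1, h2, rfl⟩ := ih.1 hp
      exact ⟨(q, a, r) :: π, List.cons_subset.2 ⟨hr, h1⟩, by simpa using h2, rfl⟩
    · rintro ⟨_ | ⟨⟨q', a', r⟩, π⟩, h1, h2, h3⟩
      · cases h3
      · obtain ⟨rfl, rfl⟩ := List.cons.inj h3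
        obtain ⟨rfl, h2⟩ := h2
        rw [List.cons_subset] at h1
        exact ⟨r, h1.1, ih.2 ⟨π, h1.2, h2, rfl⟩⟩

theorem mem_automatonSubset_iff {H : Type*} [Group H] {n : ℕ} {s : Fin n → H}
    {A : FinAutomaton (Fin n × Bool)} {g : H} :
    g ∈ automatonSubset s A ↔ ∃ π, ∃ f ∈ A.2.2, π ⊆ A.1 ∧ IsPath A.2.1 π f ∧
      pathValue (letterValue s) π = g := by
  have hval (π : List (ℕ × (Fin n × Bool) × ℕ)) :
      wordValue s (π.map fun e => e.2.1) = pathValue (letterValue s) π := by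
    rw [wordValue_eq, List.map_map]
    rfl
  constructor
  · rintro ⟨w, hw, rfl⟩
    obtain ⟨f, hf, hw⟩ := NFA.mem_accepts.1 hw
    obtain ⟨π, h1, h2, rfl⟩ := (exists_path_word A w).1 hw
    exact ⟨π, f, hf, h1, h2, (hval π).symm⟩
  · rintro ⟨π, f, hf, h1, h2, rfl⟩
    exact ⟨_, NFA.mem_accepts.2 ⟨f, hf, (exists_path_word A _).2 ⟨π, h1, h2, rfl⟩⟩, hval π⟩

section Lift

variable {ι α : Type*} [Fintype ι] (next : ι → α → ι)

/-- The edges of the product of a graph with a finite transition system. -/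
noncomputable def liftEdges (δ : List (ℕ × α × ℕ)) : List ((ℕ × ι) × (ι × α) × (ℕ × ι)) :=
  δ.flatMap fun e => (Finset.univ : Finset ι).toList.map fun j =>
    ((e.1, j), (j, e.2.1), (e.2.2, next j e.2.1))

theorem mem_liftEdges {δ : List (ℕ × α × ℕ)} {d : (ℕ × ι) × (ι × α) × (ℕ × ι)} :
    d ∈ liftEdges next δ ↔
      ∃ e ∈ δ, ∃ j, ((e.1, j), (j, e.2.1), (e.2.2, next j e.2.1)) = d := by
  simp [liftEdges]

variable {H : Type*} [Group H] (rep : ι → H) (v : α → H)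

/-- The value of a label of the product, corrected by the representatives. -/
def liftValue (c : ι × α) : H := rep c.1 * v c.2 * (rep (next c.1 c.2))⁻¹

/-- The representatives telescope along a path, so only those at its two ends survive. -/
theorem exists_lift_path {δ : List (ℕ × α × ℕ)} {p : ℕ} (π : List (ℕ × α × ℕ)) :
    ∀ (q : ℕ) (j : ι), IsPath q π p → π ⊆ δ → ∃ j' π', IsPath (q, j) π' (p, j') ∧
      π' ⊆ liftEdges next δ ∧
      pathValue (liftValue next rep v) π' = rep j * pathValue v π * (rep j')⁻¹ := by
  induction π with
  | nil =>
    rintro q j rfl -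
    exact ⟨j, [], by simp⟩
  | cons e π ih =>
    rintro q j ⟨rfl, h⟩ hδ
    rw [List.cons_subset] at hδ
    obtain ⟨j', π', h1, h2, h3⟩ := ih _ (next j e.2.1) h hδ.2
    refine ⟨j', ((e.1, j), (j, e.2.1), (e.2.2, next j e.2.1)) :: π', ⟨rfl, h1⟩,
      List.cons_subset.2 ⟨(mem_liftEdges next).2 ⟨e, hδ.1, j, rfl⟩, h2⟩, ?_⟩
    rw [pathValue_cons, h3, pathValue_cons, liftValue]
    group

theorem exists_path_of_lift {δ : List (ℕ × α × ℕ)} {p : ℕ × ι}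
    (π' : List ((ℕ × ι) × (ι × α) × (ℕ × ι))) :
    ∀ q, IsPath q π' p → π' ⊆ liftEdges next δ → ∃ π, IsPath q.1 π p.1 ∧ π ⊆ δ ∧
      pathValue (liftValue next rep v) π' = rep q.2 * pathValue v π * (rep p.2)⁻¹ := by
  induction π' with
  | nil =>
    rintro q rfl -
    exact ⟨[], by simp⟩
  | cons d π' ih =>
    rintro q ⟨rfl, h⟩ hδ
    rw [List.cons_subset] at hδ
    obtain ⟨π, h1, h2, h3⟩ := ih _ h hδ.2
    obtain ⟨e, he, j, rfl⟩ := (mem_liftEdges next).1 hδ.1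
    refine ⟨e :: π, ⟨rfl, h1⟩, List.cons_subset.2 ⟨he, h2⟩, ?_⟩
    rw [pathValue_cons, h3, pathValue_cons, liftValue]
    group

end Lift

-- The final coset `j` depends on the word read, hence the disjunction over `j`. The bound on the
-- length of `l` suffices because a list of edges without repetition is no longer than the full edge
-- list.
open HNNExtension in
theorem mem_automatonSubset_iff_exists_segment_mem {H : Type*} [Group H] {X : Subgroup H}
    (hX : X.Normal) {b : H} (hb : b ∉ X) {n : ℕ} (s : Fin n → H) {ι : Type*} [Fintype ι]
    [Encodable ι] (next : ι → Fin n × Bool → ι) (rep : ι → H)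
    (hrep : ∀ c, liftValue next rep (letterValue s) c ∈ Subgroup.centralizer (X : Set H))
    (j₀ : ι) (A : FinAutomaton (Fin n × Bool)) (g : H) :
    g ∈ automatonSubset s A ↔
      ∃ l ∈ boundedLists (liftEdges next A.1) (liftEdges next A.1).length, ∃ f ∈ A.2.2, ∃ j,
        segmentValue X b (((A.2.1, j₀), 0), rep j₀ * g * (rep j)⁻¹, ((f, j), l.length)) ∈
          Submonoid.closure
            (segmentValue X b '' layeredEdgeSet (liftValue next rep (letterValue s)) l) := by
  rw [mem_automatonSubset_iff]
  constructor
  · rintro ⟨π, f, hf, hδ, hπ, rfl⟩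
    obtain ⟨j, π', h1, h2, h3⟩ := exists_lift_path next rep (letterValue s) π _ j₀ hπ hδ
    obtain ⟨l, h4, h5, h6⟩ := exists_reach_of_isPath (liftValue next rep (letterValue s)) _ _ _ h1
    have hl := List.Subset.trans h5 h2
    refine ⟨l, mem_boundedLists.2 ⟨(List.subperm_of_subset h4 hl).length_le, hl⟩, f, hf, j, ?_⟩
    rw [← h3]
    exact segment_mem_closure h6
  · rintro ⟨l, hl, f, hf, j, h⟩
    obtain ⟨π', h1, h2, h3⟩ := exists_isPath_of_segment_mem_closure _ hb hX
      (fun e _ => hrep e.2.1) h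
    obtain ⟨π, h4, h5, h6⟩ := exists_path_of_lift next rep (letterValue s) π' _ h1
      (List.Subset.trans h2 (mem_boundedLists.1 hl).2)
    refine ⟨π, f, hf, h5, h4, ?_⟩
    rw [h3] at h6
    simpa using h6.symm

end LabelledPath

/-! ### Turing reducibility through finite disjunctions of queries -/

section OracleComputation

/-- A total function on the natural numbers that is recursive in a set of oracles. -/
def TotalRecursiveIn (O : Set (ℕ →. ℕ)) (f : ℕ → ℕ) : Prop :=
  Nat.RecursiveIn O fun n => Part.some (f n)

namespace TotalRecursiveIn

variable {O : Set (ℕ →. ℕ)} {f g : ℕ → ℕ}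

theorem of_computable (hf : Computable f) : TotalRecursiveIn O f :=
  Nat.Partrec.recursiveIn (Partrec.nat_iff.1 hf)

theorem comp (hf : TotalRecursiveIn O f) (hg : TotalRecursiveIn O g) :
    TotalRecursiveIn O fun n => f (g n) :=
  (Nat.RecursiveIn.comp hf hg).of_eq fun n => by simp

theorem pair (hf : TotalRecursiveIn O f) (hg : TotalRecursiveIn O g) :
    TotalRecursiveIn O fun n => Nat.pair (f n) (g n) :=
  (Nat.RecursiveIn.pair hf hg).of_eq fun n => by simp [Seq.seq]

theorem prec (hf : TotalRecursiveIn O f) (hg : TotalRecursiveIn O g) :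
    TotalRecursiveIn O fun p => Nat.rec (motive := fun _ => ℕ) (f p.unpair.1)
      (fun y i => g (Nat.pair p.unpair.1 (Nat.pair y i))) p.unpair.2 :=
  (Nat.RecursiveIn.prec hf hg).of_eq fun p => by
    simp only
    induction p.unpair.2 with
    | zero => rfl
    | succ k ih =>
      exact (congrArg (fun z => Part.bind z fun i =>
        Part.some (g (Nat.pair p.unpair.1 (Nat.pair k i)))) ih).trans (Part.bind_some _ _)

/-- The list is summed by primitive recursion on its length, with one oracle evaluation per step. -/
theorem list_sum {F : ℕ → List ℕ} (hF : Computable F) (hg : TotalRecursiveIn O g) :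
    TotalRecursiveIn O fun c => ((F c).map g).sum := by
  -- The default `0` is never used, since the recursion stops at the length of the list.
  have hidx : Computable fun x : ℕ => (F x.unpair.1).getD x.unpair.2.unpair.1 0 :=
    (Primrec.list_getD 0).to_comp.comp
      (hF.comp (Primrec.fst.comp Primrec.unpair).to_comp)
      (Primrec.fst.comp (Primrec.unpair.comp (Primrec.snd.comp Primrec.unpair))).to_comp
  have hacc : Computable fun x : ℕ => x.unpair.2.unpair.2 :=
    (Primrec.snd.comp (Primrec.unpair.comp (Primrec.snd.comp Primrec.unpair))).to_comp
  have hadd : Computable fun x : ℕ => x.unpair.1 + x.unpair.2 :=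
    (Primrec.nat_add.comp (Primrec.fst.comp Primrec.unpair)
      (Primrec.snd.comp Primrec.unpair)).to_comp
  have hstep : TotalRecursiveIn O fun x =>
      x.unpair.2.unpair.2 + g ((F x.unpair.1).getD x.unpair.2.unpair.1 0) := by
    simpa using (of_computable hadd).comp
      ((of_computable hacc).pair (hg.comp (of_computable hidx)))
  have hlen : Computable fun c : ℕ => Nat.pair c (F c).length :=
    Primrec₂.natPair.to_comp.comp Computable.id (Primrec.list_length.to_comp.comp hF)
  have h := ((of_computable (Computable.const 0)).prec hstep).comp (of_computable hlen)
  convert h using 2 with c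
  simp only [Nat.unpair_pair]
  have key (k : ℕ) (hk : k ≤ (F c).length) : (((F c).take k).map g).sum =
      Nat.rec (motive := fun _ => ℕ) 0 (fun y i => i + g ((F c).getD y 0)) k := by
    induction k with
    | zero => simp
    | succ k ih =>
      simp only
      rw [← ih (by omega), List.take_add_one, List.getElem?_eq_getElem (by omega),
        List.getD_eq_getElem _ _ (by omega), List.map_append, List.sum_append]
      rfl
  simpa using key _ le_rfl

end TotalRecursiveIn

/-- A problem is Turing reducible to `q` if its instances can be computably turned into finite
lists of instances of `q` whose disjunction is equivalent to the given instance. -/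
theorem problemReducible_of_disjunction {α β : Type*} [Primcodable α] [Primcodable β]
    {p : α → Prop} {q : β → Prop} {Q : α → List β} (hQ : Computable Q)
    (h : ∀ a, p a ↔ ∃ b ∈ Q a, q b) : ProblemReducible p q := by
  classical
  let g : ℕ → ℕ := fun c => if ∃ b : β, Encodable.decode c = some b ∧ q b then 1 else 0
  -- A code of no instance yields no queries, hence the answer `0`, in agreement with
  -- `problemCharFn`.
  let F : ℕ → List ℕ := fun c =>
    ((Encodable.decode c : Option α).map fun a => (Q a).map Encodable.encode).getD []
  have hF : Computable F := by
    refine Computable.option_getD (Computable.option_map Computable.decode ?_) (Computable.const [])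
    exact ((Primrec.list_map Primrec.id (Primrec.encode.comp₂ Primrec₂.right)).to_comp.comp
      (hQ.comp Computable.snd))
  have hg : TotalRecursiveIn {problemCharFn q} g := by
    have : problemCharFn q = fun c => Part.some (g c) := by
      funext c
      simp only [problemCharFn, g]
    unfold TotalRecursiveIn
    rw [← this]
    exact .oracle _ rfl
  -- Truncated subtraction turns the number of positive answers into `0` or `1`.
  have hmin : Computable fun k : ℕ => 1 - (1 - k) :=
    (Primrec.nat_sub.comp (Primrec.const 1)
      (Primrec.nat_sub.comp (Primrec.const 1) Primrec.id)).to_comp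
  have hmain := (TotalRecursiveIn.of_computable hmin).comp (TotalRecursiveIn.list_sum hF hg)
  rw [ProblemReducible, TuringReducible, RecursiveIn.iff_nat]
  refine hmain.of_eq fun c => ?_
  rw [problemCharFn]
  refine congrArg Part.some ?_
  change 1 - (1 - ((F c).map g).sum) = _
  have hiff : ((F c).map g).sum ≠ 0 ↔ ∃ a : α, Encodable.decode c = some a ∧ p a := by
    rw [Ne, List.sum_eq_zero_iff]
    cases hc : (Encodable.decode c : Option α) with
    | none => simp [F, hc]
    | some a => simp [F, hc, g, h]
  split_ifs with hc
  · have := hiff.2 hc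
    omega
  · have := not_not.1 (mt hiff.1 hc)
    omega

end OracleComputation

/-! ### Decidability of finite disjunctions -/

section FiniteDisjunction

theorem ComputablePred.or_of {α : Type*} [Primcodable α] {p q : α → Prop}
    (hp : ComputablePred p) (hq : ComputablePred q) : ComputablePred fun a => p a ∨ q a := by
  obtain ⟨f, hf, rfl⟩ := ComputablePred.computable_iff.1 hp
  obtain ⟨g, hg, rfl⟩ := ComputablePred.computable_iff.1 hq
  refine ComputablePred.computable_iff.2
    ⟨fun a => f a || g a, Primrec.or.to_comp.comp hf hg, ?_⟩
  funext a
  simp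

theorem ComputablePred.exists_mem_list {α β : Type*} [Primcodable α] {p : β → α → Prop} :
    ∀ L : List β, (∀ b ∈ L, ComputablePred (p b)) → ComputablePred fun a => ∃ b ∈ L, p b a
  | [], _ => (ComputablePred.computable_iff.2 ⟨fun _ => false, Computable.const false, rfl⟩).of_eq
      (by simp)
  | b :: L, hL => by
    refine ((hL b List.mem_cons_self).or_of (ComputablePred.exists_mem_list L fun b hb =>
      hL b (List.mem_cons_of_mem _ hb))).of_eq ?_
    simp

end FiniteDisjunction

/-! ### The reduction: its finite data, computability and correctness -/

open LabelledPath HNNExtension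

/-- The fixed finite data of the reduction: words for the stable letter, for the base element and
their inverses, for the letters of the base group, for the labels of the product automaton, and for
the coset representatives. -/
structure ReductionData (n m : ℕ) (ι : Type) where
  /-- A word for the stable letter. -/
  stable : GroupWord m
  /-- A word for the inverse of the stable letter. -/
  stableInv : GroupWord m
  /-- A word for the base element. -/
  base : GroupWord m
  /-- A word for the inverse of the base element. -/
  baseInv : GroupWord m
  /-- Words for the letters of the base group. -/
  letter : Fin n × Bool → GroupWord m
  /-- Words for the labels of the product automaton. -/
  label : ι × (Fin n × Bool) → GroupWord m
  /-- The action of letters on cosets. -/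
  next : ι → Fin n × Bool → ι
  /-- The initial coset. -/
  initial : ι
  /-- A word for the initial coset representative. -/
  pre : GroupWord m
  /-- Words for the inverses of the coset representatives. -/
  post : ι → GroupWord m

namespace ReductionData

variable {n m : ℕ} {ι : Type} [Primcodable ι] (D : ReductionData n m ι)

/-- A word for the segment `(q, u, p)`. -/
def segmentWord (q : (ℕ × ι) × ℕ) (u : GroupWord m) (p : (ℕ × ι) × ℕ) : GroupWord m :=
  (wordPow D.stable (Encodable.encode q + 1) ++ D.base ++
      wordPow D.stable (Encodable.encode q + 1)) ++ u ++
    (wordPow D.stableInv (Encodable.encode p + 1) ++ D.baseInv ++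
      wordPow D.stableInv (Encodable.encode p + 1))

/-- The generators of the submonoid attached to a list of edges. -/
def generators (l : List ((ℕ × ι) × (ι × (Fin n × Bool)) × (ℕ × ι))) : List (GroupWord m) :=
  (layeredEdges l).map fun d => D.segmentWord d.1 (D.label d.2.1) d.2.2

/-- The word whose membership in the submonoid is asked for. -/
def target (q₀ f : ℕ) (j : ι) (k : ℕ) (w : GroupWord n) : GroupWord m :=
  D.segmentWord ((q₀, D.initial), 0) (D.pre ++ w.flatMap D.letter ++ D.post j) ((f, j), k)

/-- The instances of the submonoid membership problem attached to an instance of the rational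
subset membership problem. -/
noncomputable def instances [Fintype ι] (I : GroupWord n × FinAutomaton (Fin n × Bool)) :
    List (GroupWord m × List (GroupWord m)) :=
  (boundedLists (liftEdges D.next I.2.1) (liftEdges D.next I.2.1).length).flatMap fun l =>
    I.2.2.2.flatMap fun f => (Finset.univ : Finset ι).toList.map fun j =>
      (D.target I.2.2.1 f j l.length I.1, D.generators l)

section Computability

theorem primrec_option_toList {α : Type*} [Primcodable α] : Primrec (@Option.toList α) :=
  (Primrec.option_casesOn Primrec.id (Primrec.const [])
    (Primrec.list_cons.comp Primrec.snd (Primrec.const [])).to₂).of_eq fun o => by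
      cases o <;> rfl

theorem primrec_boundedLists {α : Type*} [Primcodable α] : Primrec₂ (@boundedLists α) := by
  have : Primrec₂ fun (L : List α) (k : ℕ) => Nat.rec (motive := fun _ => List (List α)) [[]]
      (fun _ B => [] :: B.flatMap fun l => L.map fun a => a :: l) k := by
    have hmap : Primrec₂ fun (x : List α × ℕ × List (List α)) (l : List α) =>
        x.1.map fun a => a :: l :=
      Primrec.list_map (Primrec.fst.comp Primrec.fst)
        (Primrec.list_cons.comp Primrec.snd (Primrec.snd.comp Primrec.fst))
    have hstep : Primrec fun x : List α × ℕ × List (List α) =>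
        [] :: x.2.2.flatMap fun l => x.1.map fun a => a :: l :=
      Primrec.list_cons.comp (Primrec.const [])
        (Primrec.list_flatMap (Primrec.snd.comp Primrec.snd) hmap)
    exact Primrec.nat_rec (Primrec.const [[]]) hstep.to₂
  refine this.of_eq fun L k => ?_
  induction k with
  | zero => rfl
  | succ k ih => simp only [boundedLists, ← ih]

theorem primrec_liftEdges [Fintype ι] {α : Type} [Primcodable α] [Finite α] (next : ι → α → ι) :
    Primrec (liftEdges next) := by
  have hnext : Primrec₂ next := Primrec.dom_finite _
  refine Primrec.list_flatMap Primrec.id ?_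
  refine Primrec.list_map (Primrec.const _) ?_
  have he : Primrec fun x : (List (ℕ × α × ℕ) × (ℕ × α × ℕ)) × ι => x.1.2 :=
    Primrec.snd.comp Primrec.fst
  have ha : Primrec fun x : (List (ℕ × α × ℕ) × (ℕ × α × ℕ)) × ι => x.1.2.2.1 :=
    Primrec.fst.comp (Primrec.snd.comp he)
  exact (((Primrec.fst.comp he).pair Primrec.snd).pair ((Primrec.snd.pair ha).pair
    ((Primrec.snd.comp (Primrec.snd.comp he)).pair (hnext.comp Primrec.snd ha))))

theorem primrec_layeredEdges {τ Λ : Type*} [Primcodable τ] [Primcodable Λ] :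
    Primrec (@layeredEdges τ Λ) := by
  refine Primrec.list_flatMap
    (Primrec.list_range.comp (Primrec.succ.comp Primrec.list_length)) ?_
  refine Primrec.list_append.comp ?_ ?_
  · refine Primrec.list_map Primrec.fst ?_
    have he : Primrec fun x : (List (τ × Λ × τ) × ℕ) × (τ × Λ × τ) => x.2 := Primrec.snd
    have hi : Primrec fun x : (List (τ × Λ × τ) × ℕ) × (τ × Λ × τ) => x.1.2 :=
      Primrec.snd.comp Primrec.fst
    exact ((Primrec.fst.comp he).pair hi).pair ((Primrec.fst.comp (Primrec.snd.comp he)).pair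
      ((Primrec.snd.comp (Primrec.snd.comp he)).pair hi))
  · refine primrec_option_toList.comp (Primrec.option_map
      (Primrec.list_getElem?.comp Primrec.fst Primrec.snd) ?_)
    have he : Primrec fun x : (List (τ × Λ × τ) × ℕ) × (τ × Λ × τ) => x.2 := Primrec.snd
    have hi : Primrec fun x : (List (τ × Λ × τ) × ℕ) × (τ × Λ × τ) => x.1.2 :=
      Primrec.snd.comp Primrec.fst
    exact ((Primrec.fst.comp he).pair hi).pair ((Primrec.fst.comp (Primrec.snd.comp he)).pair
      ((Primrec.snd.comp (Primrec.snd.comp he)).pair (Primrec.succ.comp hi)))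

theorem primrec_wordPow (w : GroupWord m) : Primrec (wordPow w) :=
  Primrec.list_flatMap Primrec.list_range (Primrec.const w).to₂

theorem primrec_segmentWord {α : Type*} [Primcodable α] {q p : α → (ℕ × ι) × ℕ}
    {u : α → GroupWord m} (hq : Primrec q) (hu : Primrec u) (hp : Primrec p) :
    Primrec fun a => D.segmentWord (q a) (u a) (p a) := by
  have h (w : GroupWord m) {q : α → (ℕ × ι) × ℕ} (hq : Primrec q) :
      Primrec fun a => wordPow w (Encodable.encode (q a) + 1) :=
    (primrec_wordPow w).comp (Primrec.succ.comp (Primrec.encode.comp hq))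
  exact Primrec.list_append.comp (Primrec.list_append.comp
    (Primrec.list_append.comp (Primrec.list_append.comp (h _ hq) (Primrec.const _)) (h _ hq)) hu)
    (Primrec.list_append.comp (Primrec.list_append.comp (h _ hp) (Primrec.const _)) (h _ hp))

theorem primrec_generators [Finite ι] : Primrec D.generators := by
  refine Primrec.list_map primrec_layeredEdges ?_
  refine D.primrec_segmentWord (Primrec.fst.comp Primrec.snd) ?_
    (Primrec.snd.comp (Primrec.snd.comp Primrec.snd))
  exact (Primrec.dom_finite D.label).comp (Primrec.fst.comp (Primrec.snd.comp Primrec.snd))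

theorem primrec_target [Finite ι] {α : Type*} [Primcodable α] {q₀ f : α → ℕ} {j : α → ι} {k : α → ℕ}
    {w : α → GroupWord n} (hq : Primrec q₀) (hf : Primrec f) (hj : Primrec j) (hk : Primrec k)
    (hw : Primrec w) : Primrec fun a => D.target (q₀ a) (f a) (j a) (k a) (w a) := by
  refine D.primrec_segmentWord ((hq.pair (Primrec.const _)).pair (Primrec.const 0)) ?_
    ((hf.pair hj).pair hk)
  exact Primrec.list_append.comp (Primrec.list_append.comp (Primrec.const _)
    (Primrec.list_flatMap hw ((Primrec.dom_finite D.letter).comp Primrec.snd).to₂))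
    ((Primrec.dom_finite D.post).comp hj)

theorem primrec_instances [Fintype ι] : Primrec D.instances := by
  have hlift : Primrec fun I : GroupWord n × FinAutomaton (Fin n × Bool) =>
      liftEdges D.next I.2.1 :=
    (primrec_liftEdges D.next).comp (Primrec.fst.comp Primrec.snd)
  refine Primrec.list_flatMap
    (primrec_boundedLists.comp hlift (Primrec.list_length.comp hlift)) ?_
  refine Primrec.list_flatMap
    (Primrec.snd.comp (Primrec.snd.comp (Primrec.snd.comp Primrec.fst))) ?_
  refine Primrec.list_map (Primrec.const _) ?_
  refine Primrec.pair (D.primrec_target ?_ ?_ ?_ ?_ ?_) (D.primrec_generators.comp ?_)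
  · exact Primrec.fst.comp (Primrec.snd.comp (Primrec.snd.comp
      (Primrec.fst.comp (Primrec.fst.comp Primrec.fst))))
  · exact Primrec.snd.comp Primrec.fst
  · exact Primrec.snd
  · exact Primrec.list_length.comp (Primrec.snd.comp (Primrec.fst.comp Primrec.fst))
  · exact Primrec.fst.comp (Primrec.fst.comp (Primrec.fst.comp Primrec.fst))
  · exact Primrec.snd.comp (Primrec.fst.comp Primrec.fst)

end Computability

section Correctness

variable {H : Type*} [Group H] {X : Subgroup H}

/-- The words of the reduction have the intended values. -/
structure Realizes (s : Fin n → H) (r : Fin m → SelfExtension X) (b : H) (rep : ι → H) :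
    Prop where
  stable : wordValue r D.stable = t
  stableInv : wordValue r D.stableInv = t⁻¹
  base : wordValue r D.base = of b
  baseInv : wordValue r D.baseInv = (of b)⁻¹
  letter : ∀ a, wordValue r (D.letter a) = of (letterValue s a)
  label : ∀ c, wordValue r (D.label c) = of (liftValue D.next rep (letterValue s) c)
  pre : wordValue r D.pre = of (rep D.initial)
  post : ∀ j, wordValue r (D.post j) = of (rep j)⁻¹

variable {D} {s : Fin n → H} {r : Fin m → SelfExtension X} {b : H} {rep : ι → H}

theorem Realizes.wordValue_segmentWord (hD : D.Realizes s r b rep) (q p : (ℕ × ι) × ℕ)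
    {u : GroupWord m} {g : H} (hu : wordValue r u = of g) :
    wordValue r (D.segmentWord q u p) = segmentValue X b (q, g, p) := by
  simp [segmentWord, wordValue_wordPow, hD.stable, hD.stableInv, hD.base, hD.baseInv, hu, segmentValue,
    marker, mul_assoc]

theorem Realizes.generators_eq (hD : D.Realizes s r b rep)
    (l : List ((ℕ × ι) × (ι × (Fin n × Bool)) × (ℕ × ι))) :
    {g | ∃ v ∈ D.generators l, wordValue r v = g} =
      segmentValue X b '' layeredEdgeSet (liftValue D.next rep (letterValue s)) l := by
  ext g
  constructor
  · rintro ⟨v, hv, rfl⟩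
    obtain ⟨d, hd, rfl⟩ := List.mem_map.1 hv
    exact ⟨_, ⟨d, hd, rfl⟩, (hD.wordValue_segmentWord _ _ (hD.label _)).symm⟩
  · rintro ⟨_, ⟨d, hd, rfl⟩, rfl⟩
    exact ⟨_, List.mem_map_of_mem hd, hD.wordValue_segmentWord _ _ (hD.label _)⟩

theorem Realizes.wordValue_target (hD : D.Realizes s r b rep) (q₀ f : ℕ) (j : ι) (k : ℕ)
    (w : GroupWord n) : wordValue r (D.target q₀ f j k w) =
      segmentValue X b (((q₀, D.initial), 0), rep D.initial * wordValue s w * (rep j)⁻¹,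
        ((f, j), k)) := by
  refine hD.wordValue_segmentWord _ _ ?_
  rw [wordValue_append, wordValue_append, hD.pre, hD.post,
    wordValue_flatMap of s r D.letter hD.letter, map_mul, map_mul]

theorem Realizes.mem_automatonSubset_iff [Fintype ι] (hD : D.Realizes s r b rep) (hX : X.Normal)
    (hb : b ∉ X) (hrep : ∀ c, liftValue D.next rep (letterValue s) c ∈
      Subgroup.centralizer (X : Set H)) (w : GroupWord n) (A : FinAutomaton (Fin n × Bool)) :
    wordValue s w ∈ automatonSubset s A ↔
      ∃ l ∈ boundedLists (liftEdges D.next A.1) (liftEdges D.next A.1).length,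
        ∃ f ∈ A.2.2, ∃ j, SubmonoidMembership r
          (D.target A.2.1 f j l.length w, D.generators l) := by
  rw [mem_automatonSubset_iff_exists_segment_mem hX hb s D.next rep hrep D.initial]
  simp only [SubmonoidMembership, hD.generators_eq, hD.wordValue_target]

theorem Realizes.problemReducible [Fintype ι] (hD : D.Realizes s r b rep) (hX : X.Normal)
    (hb : b ∉ X) (hrep : ∀ c, liftValue D.next rep (letterValue s) c ∈
      Subgroup.centralizer (X : Set H)) :
    ProblemReducible (RationalMembership s) (SubmonoidMembership r) := by
  refine problemReducible_of_disjunction D.primrec_instances.to_comp fun I => ?_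
  rw [RationalMembership, hD.mem_automatonSubset_iff hX hb hrep]
  constructor
  · rintro ⟨l, hl, f, hf, j, h⟩
    exact ⟨_, List.mem_flatMap.2 ⟨l, hl, List.mem_flatMap.2 ⟨f, hf, List.mem_map.2
      ⟨j, by simp, rfl⟩⟩⟩, h⟩
  · rintro ⟨J, hJ, h⟩
    obtain ⟨l, hl, hJ⟩ := List.mem_flatMap.1 hJ
    obtain ⟨f, hf, hJ⟩ := List.mem_flatMap.1 hJ
    obtain ⟨j, -, rfl⟩ := List.mem_map.1 hJ
    exact ⟨l, hl, f, hf, j, h⟩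

/-- For fixed `A` the generators range over finitely many lists that do not depend on the input
word; only the target word varies with it, computably. -/
theorem Realizes.computablePred [Fintype ι] (hD : D.Realizes s r b rep) (hX : X.Normal)
    (hb : b ∉ X) (hrep : ∀ c, liftValue D.next rep (letterValue s) c ∈
      Subgroup.centralizer (X : Set H))
    (h : ∀ M : Submonoid (SelfExtension X), M.FG →
      ComputablePred (FixedMembership r (M : Set (SelfExtension X))))
    (A : FinAutomaton (Fin n × Bool)) :
    ComputablePred (FixedMembership s (automatonSubset s A)) := by
  have hone (l) (f : ℕ) (j : ι) : ComputablePred fun w => SubmonoidMembership r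
      (D.target A.2.1 f j l.length w, D.generators l) := by
    have hfg : (Submonoid.closure {g | ∃ v ∈ D.generators l, wordValue r v = g}).FG := by
      refine (Submonoid.fg_iff _).2 ⟨_, rfl, ?_⟩
      exact (List.finite_toSet (D.generators l)).image (wordValue r)
    have htarget : Computable fun w => D.target A.2.1 f j l.length w :=
      (D.primrec_target (Primrec.const _) (Primrec.const f) (Primrec.const j)
        (Primrec.const _) Primrec.id).to_comp
    exact ComputablePred.computable_of_manyOneReducible ⟨_, htarget, fun w => Iff.rfl⟩ (h _ hfg)
  refine (ComputablePred.exists_mem_list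
    (boundedLists (liftEdges D.next A.1) (liftEdges D.next A.1).length) fun l _ =>
    ComputablePred.exists_mem_list A.2.2 fun f _ =>
      ComputablePred.exists_mem_list (Finset.univ : Finset ι).toList fun j _ =>
        hone l f j).of_eq fun w => ?_
  rw [FixedMembership, hD.mem_automatonSubset_iff hX hb hrep]
  simp

end Correctness

end ReductionData

-- The centralizer of `X` is the kernel of the conjugation action on the finite group `X`, so it is
-- normal of finite index. The automaton tracks the coset of the corrected prefix, and old
-- representative times letter lies in the same coset as the new representative. The words are
-- chosen non-effectively, but they are finitely many constants.
open ReductionData in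
theorem exists_reductionData {H : Type*} [Group H] {X : Subgroup H} (hX : X.Normal)
    (hXfinite : (X : Set H).Finite) (b : H) {n : ℕ} (s : Fin n → H) {m : ℕ}
    (r : Fin m → SelfExtension X) (hr : GeneratesGroup r) :
    ∃ (d : ℕ) (D : ReductionData n m (Fin d)) (rep : Fin d → H), D.Realizes s r b rep ∧
      ∀ c, liftValue D.next rep (letterValue s) c ∈ Subgroup.centralizer (X : Set H) := by
  have : Finite X := hXfinite
  have hker : (MulAut.conjNormal (H := X)).ker = Subgroup.centralizer (X : Set H) := by
    ext g
    rw [MonoidHom.mem_ker, Subgroup.mem_centralizer_iff, MulEquiv.ext_iff]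
    simp only [Subtype.forall, Subtype.ext_iff, MulAut.conjNormal_apply, MulAut.one_apply,
      mul_inv_eq_iff_eq_mul]
    exact forall₂_congr fun x _ => eq_comm
  have : Finite (H ⧸ (MulAut.conjNormal (H := X)).ker) :=
    Finite.of_injective _ (QuotientGroup.kerLift_injective _)
  let e := Finite.equivFin (H ⧸ (MulAut.conjNormal (H := X)).ker)
  let rep : Fin (Nat.card (H ⧸ (MulAut.conjNormal (H := X)).ker)) → H := fun j =>
    (e.symm j).out
  let W := Function.surjInv (wordValue_surjective hr)
  have hW (g : SelfExtension X) : wordValue r (W g) = g := Function.surjInv_eq _ g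
  let next := fun j a => e (QuotientGroup.mk (rep j * letterValue s a))
  refine ⟨_, ⟨W t, W t⁻¹, W (of b), W (of b)⁻¹, fun a => W (of (letterValue s a)),
    fun c => W (of (liftValue next rep (letterValue s) c)), next, e 1, W (of (rep (e 1))),
    fun j => W (of (rep j)⁻¹)⟩, rep, ⟨hW _, hW _, hW _, hW _, fun _ => hW _, fun _ => hW _,
    hW _, fun _ => hW _⟩, ?_⟩
  rintro ⟨j, a⟩
  rw [← hker, liftValue, ← div_eq_mul_inv, ← QuotientGroup.eq_iff_div_mem]
  simp [rep, next]

theorem lemma5 {H : Type*} [Group H] (X : Subgroup H) (hXnormal : X.Normal)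
    (hXfinite : (X : Set H).Finite) (hXproper : X ≠ ⊤)
    {n : ℕ} (s : Fin n → H) (hs : GeneratesGroup s)
    {m : ℕ} (r : Fin m → HNNExtension H X X (MulEquiv.refl X)) (hr : GeneratesGroup r) :
    ProblemReducible (RationalMembership s) (SubmonoidMembership r) ∧
    ((∃ R : Set H, IsRationalSubset s R ∧ ¬ ComputablePred (FixedMembership s R)) →
      ∃ M : Submonoid (HNNExtension H X X (MulEquiv.refl X)),
        M.FG ∧ ¬ ComputablePred (FixedMembership r
          (M : Set (HNNExtension H X X (MulEquiv.refl X))))) := by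
  obtain ⟨b, hb⟩ : ∃ b, b ∉ X := by
    by_contra! h
    exact hXproper (Subgroup.eq_top_iff' X |>.2 h)
  obtain ⟨d, D, rep, hD, hrep⟩ := exists_reductionData hXnormal hXfinite b s r hr
  refine ⟨hD.problemReducible hXnormal hb hrep, ?_⟩
  rintro ⟨_, ⟨A, rfl⟩, hR⟩
  by_contra! h
  exact hR (hD.computablePred hXnormal hb hrep h A)
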